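/- Let $\mathbb F$ be an algebraically closed field and let $$L(\lambda)=\begin{bmatrix} M(\lambda) & K_2(\lambda)^T\\ K_1(\lambda) & 0\end{bmatrix}$$ be a block full rank pencil over $\mathbb F$: a polynomial matrix whose entries have degree at most $1$, where $M\in\mathbb F[\lambda]^{n_2\times n_1}$ and where $K_i\in\mathbb F[\lambda]^{p_i\times n_i}$ ($i=1,2$) has full row rank over $\mathbb F(\lambda)$; $K_1$ or $K_2$ may be empty ($p_i=0$). For $i=1,2$ let $N_i\in\mathbb F(\lambda)^{q_i\times n_i}$ be any rational basis dual to $K_i$, that is, $N_i$ has full row rank over $\mathbb F(\lambda)$, $p_i+q_i=n_i$ and $K_iN_i^T=0$. Let $\Omega\subseteq\mathbb F$ be nonempty, and suppose that $K_1,K_2,N_1,N_2$ have full row rank in $\Omega$, where a rational matrix $R$ with $p$ rows has full row rank in $\Omega$ if for every $\lambda_0\in\Omega$ all its entries are defined at $\lambda_0$ and $\operatorname{rank}R(\lambda_0)=p$. Put $$G(\lambda)=N_2(\lambda)M(\lambda)N_1(\lambda)^T\in\mathbb F(\lambda)^{q_2\times q_1}.$$ Then $L$ is a linearization of $G$ in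 $\Omega$ with empty state matrix, that is, for every $\lambda_0\in\Omega$ there are integers $s_1,s_2\ge0$ with $s_1-s_2=(n_2+p_1)-q_2=(n_1+p_2)-q_1$ and square rational matrices $R_1,R_2$ regular at $\lambda_0$ (all entries defined at $\lambda_0$ and $\det R_j(\lambda_0)\ne0$) such that $$R_1\,\operatorname{diag}(G,I_{s_1})\,R_2=\operatorname{diag}(L,I_{s_2}).$$ Moreover, $L$ and $\operatorname{diag}(G,I_{p_1+p_2})$ are equivalent in $\Omega$: there are square rational matrices $R_1,R_2$, each regular at every point of $\Omega$, with $R_1LR_2=\operatorname{diag}(G,I_{p_1+p_2})$. -/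

import Mathlib

open Polynomial

namespace LocalLinearization

noncomputable section

/-- A polynomial matrix regarded as a rational matrix. -/
def toRat {F : Type*} [Field F] {p m : ℕ} (P : Matrix (Fin p) (Fin m) F[X]) :
    Matrix (Fin p) (Fin m) (RatFunc F) :=
  P.map (algebraMap F[X] (RatFunc F))

/-- The value at `z` of a polynomial matrix. -/
def polyValueAt {F : Type*} [Field F] {ι κ : Type*} (P : Matrix ι κ F[X]) (z : F) :
    Matrix ι κ F :=
  P.map (Polynomial.eval z)

/-- The rational matrix `R` is defined (bounded) at `z`: no entry, written in lowest terms, has a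
denominator vanishing at `z`. -/
def DefinedAt {F : Type*} [Field F] {p m : ℕ} (R : Matrix (Fin p) (Fin m) (RatFunc F)) (z : F) :
    Prop :=
  ∀ i j, (R i j).denom.eval z ≠ 0

/-- The value `R(z)` of a rational matrix; meaningful only if `DefinedAt R z`. -/
def valueAt {F : Type*} [Field F] {p m : ℕ} (R : Matrix (Fin p) (Fin m) (RatFunc F)) (z : F) :
    Matrix (Fin p) (Fin m) F :=
  R.map (RatFunc.eval (RingHom.id F) z)

/-- The square rational matrix `R` is regular (invertible) at `z`. -/
def RegularAt {F : Type*} [Field F] {m : ℕ} (R : Matrix (Fin m) (Fin m) (RatFunc F)) (z : F) :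
    Prop :=
  DefinedAt R z ∧ (valueAt R z).det ≠ 0

/-- `R` is regular in the set `S`. -/
def RegularIn {F : Type*} [Field F] {m : ℕ} (R : Matrix (Fin m) (Fin m) (RatFunc F)) (S : Set F) :
    Prop :=
  ∀ z ∈ S, RegularAt R z

/-- Two rational matrices of the same size are equivalent in `S`. -/
def EquivalentIn {F : Type*} [Field F] {p m : ℕ} (G H : Matrix (Fin p) (Fin m) (RatFunc F))
    (S : Set F) : Prop :=
  ∃ (R₁ : Matrix (Fin p) (Fin p) (RatFunc F)) (R₂ : Matrix (Fin m) (Fin m) (RatFunc F)),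
    RegularIn R₁ S ∧ RegularIn R₂ S ∧ R₁ * G * R₂ = H

/-- `R` has full row rank in `S`: it is defined with `rank R(z) = p` at all `z ∈ S`. -/
def FullRowRankIn {F : Type*} [Field F] {p m : ℕ} (R : Matrix (Fin p) (Fin m) (RatFunc F))
    (S : Set F) : Prop :=
  ∀ z ∈ S, DefinedAt R z ∧ (valueAt R z).rank = p

/-- A matrix pencil (linear polynomial matrix): all entries have degree at most one. -/
def IsPencil {F : Type*} [Field F] {p m : ℕ} (P : Matrix (Fin p) (Fin m) F[X]) : Prop :=
  ∀ i j, (P i j).natDegree ≤ 1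

/-- The `2 × 2` block matrix `[A B; C D]` with rows and columns numbered consecutively. -/
def block {R : Type*} {a b c d : ℕ} (A : Matrix (Fin a) (Fin c) R) (B : Matrix (Fin a) (Fin d) R)
    (C : Matrix (Fin b) (Fin c) R) (D : Matrix (Fin b) (Fin d) R) :
    Matrix (Fin (a + b)) (Fin (c + d)) R :=
  Matrix.reindex finSumFinEquiv finSumFinEquiv (Matrix.fromBlocks A B C D)

/-- `diag(G, I_s)`. -/
def diagId {F : Type*} [Field F] {p m : ℕ} (G : Matrix (Fin p) (Fin m) (RatFunc F)) (s : ℕ) :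
    Matrix (Fin (p + s)) (Fin (m + s)) (RatFunc F) :=
  block G 0 0 1

/-- A polynomial system matrix `[A B; -C D]`, partitioned, with `n × n` state matrix `A` that is
nonsingular if `n > 0`. -/
structure PolynomialSystemMatrix (F : Type*) [Field F] (n q r : ℕ) where
  /-- the state matrix -/
  A : Matrix (Fin n) (Fin n) F[X]
  B : Matrix (Fin n) (Fin r) F[X]
  C : Matrix (Fin q) (Fin n) F[X]
  D : Matrix (Fin q) (Fin r) F[X]
  nonsingular : 0 < n → A.det ≠ 0

namespace PolynomialSystemMatrix

/-- The polynomial matrix `[A B; -C D]`. -/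
def toMatrix {F : Type*} [Field F] {n q r : ℕ} (P : PolynomialSystemMatrix F n q r) :
    Matrix (Fin (n + q)) (Fin (n + r)) F[X] :=
  block P.A P.B (-P.C) P.D

/-- The transfer function matrix `D + C A⁻¹ B`. -/
def transfer {F : Type*} [Field F] {n q r : ℕ} (P : PolynomialSystemMatrix F n q r) :
    Matrix (Fin q) (Fin r) (RatFunc F) :=
  toRat P.D + toRat P.C * (toRat P.A)⁻¹ * toRat P.B

/-- Minimality at `z`: `rank [A(z); C(z)] = rank [A(z) B(z)] = n`. For `n = 0` this always
holds. -/
def MinimalAt {F : Type*} [Field F] {n q r : ℕ} (P : PolynomialSystemMatrix F n q r) (z : F) :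
    Prop :=
  (polyValueAt (Matrix.fromRows P.A P.C) z).rank = n ∧
    (polyValueAt (Matrix.fromCols P.A P.B) z).rank = n

/-- The linear polynomial system matrix `P` is a linearization of the rational matrix `G` at `z`:
it is minimal at `z`, and `R₁ diag(G, I_{s₁}) R₂ = diag(Ĝ, I_{s₂})` for some `s₁, s₂` with
`s₁ - s₂ = q - p = r - m` and some `R₁, R₂` regular at `z`, where `Ĝ` is the transfer function
matrix of `P`. The reindexing by `finCongr` only identifies `Fin a` with `Fin b` for `a = b`. -/
def IsLinearizationAt {F : Type*} [Field F] {n q r p m : ℕ} (P : PolynomialSystemMatrix F n q r)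
    (G : Matrix (Fin p) (Fin m) (RatFunc F)) (z : F) : Prop :=
  IsPencil P.toMatrix ∧ P.MinimalAt z ∧
    ∃ (s₁ s₂ : ℕ) (hr : q + s₂ = p + s₁) (hc : r + s₂ = m + s₁)
      (R₁ : Matrix (Fin (p + s₁)) (Fin (p + s₁)) (RatFunc F))
      (R₂ : Matrix (Fin (m + s₁)) (Fin (m + s₁)) (RatFunc F)),
      RegularAt R₁ z ∧ RegularAt R₂ z ∧
        R₁ * diagId G s₁ * R₂ =
          Matrix.reindex (finCongr hr) (finCongr hc) (diagId P.transfer s₂)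

/-- `P` is a linearization of `G` in the set `S`. -/
def IsLinearizationIn {F : Type*} [Field F] {n q r p m : ℕ} (P : PolynomialSystemMatrix F n q r)
    (G : Matrix (Fin p) (Fin m) (RatFunc F)) (S : Set F) : Prop :=
  ∀ z ∈ S, P.IsLinearizationAt G z

/-- The polynomial matrix `D`, viewed as a polynomial system matrix with empty state matrix. -/
def ofEmptyState {F : Type*} [Field F] {q r : ℕ} (D : Matrix (Fin q) (Fin r) F[X]) :
    PolynomialSystemMatrix F 0 q r where
  A := 0
  B := 0
  C := 0
  D := D
  nonsingular := fun h => absurd h (lt_irrefl 0)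

end PolynomialSystemMatrix

/-- The block matrix `[M K₂ᵀ; K₁ 0]`. -/
def blockPencil {F : Type*} [Field F] {p₁ n₁ p₂ n₂ : ℕ} (M : Matrix (Fin n₂) (Fin n₁) F[X])
    (K₁ : Matrix (Fin p₁) (Fin n₁) F[X]) (K₂ : Matrix (Fin p₂) (Fin n₂) F[X]) :
    Matrix (Fin (n₂ + p₁)) (Fin (n₁ + p₂)) F[X] :=
  block M K₂.transpose K₁ 0

/-- `[M K₂ᵀ; K₁ 0]` is a block full rank pencil: it is a pencil, and `K₁`, `K₂` have full row
normal rank. The blocks `K₁`, `K₂` may be empty. -/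
def IsBlockFullRankPencil {F : Type*} [Field F] {p₁ n₁ p₂ n₂ : ℕ}
    (M : Matrix (Fin n₂) (Fin n₁) F[X])
    (K₁ : Matrix (Fin p₁) (Fin n₁) F[X]) (K₂ : Matrix (Fin p₂) (Fin n₂) F[X]) : Prop :=
  IsPencil (blockPencil M K₁ K₂) ∧ (toRat K₁).rank = p₁ ∧ (toRat K₂).rank = p₂

/-- A rational basis: a rational matrix of full row normal rank. The number of rows may equal the
number of columns or be zero, so that an empty matrix has the square regular matrices as duals. -/
def IsRationalBasis {F : Type*} [Field F] {p m : ℕ} (G : Matrix (Fin p) (Fin m) (RatFunc F)) :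
    Prop :=
  G.rank = p

/-- Dual rational bases. -/
def AreDualRationalBases {F : Type*} [Field F] {p q m : ℕ}
    (G : Matrix (Fin p) (Fin m) (RatFunc F)) (H : Matrix (Fin q) (Fin m) (RatFunc F)) : Prop :=
  IsRationalBasis G ∧ IsRationalBasis H ∧ p + q = m ∧ G * H.transpose = 0

end

end LocalLinearization

/-!
Let `A` be the ring `definedOn Ω` of rational functions without poles in `Ω`. All the matrices
in question have entries in `A`, and a square matrix invertible over `A` is regular at every point
of `Ω` (`regularIn_map_subtype`), so it suffices to transform `L = [M K₂ᵀ; K₁ 0]` into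
`diag(N₂ M N₁ᵀ, I)` by invertible matrices over `A`.

The point is that a matrix over `A` of full row rank at each point of `Ω` has a right inverse over
`A` (`exists_right_inverse`). At a single point this is Cramer's rule, up to a factor that does not
vanish there; the local solutions are glued through the principal ideal of the polynomials `a` for
which `a • 1` factors through the matrix, whose generator vanishes nowhere on `Ω` and is therefore a
unit of `A`. That `Ω` is nonempty ensures that the generator is not zero.

With right inverses `C` of `K` and `B` of `N` adjusted to `Cᵀ B = 0`, the relation `K Nᵀ = 0` makes
`[K; Bᵀ]` and `[C Nᵀ]` inverse to each other (`exists_orthogonal_right_inverses`). Multiplying `M`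
by `[N₂; C₂ᵀ]` and `[N₁ᵀ C₁]` turns the blocks `K₁` and `K₂ᵀ` of `L` into identity blocks next to
zeros, which clear everything of `[N₂; C₂ᵀ] M [N₁ᵀ C₁]` but its corner `N₂ M N₁ᵀ`
(`exists_block_equiv`). The resulting equivalence on all of `Ω` also shows that `L` is a
linearization at each point of `Ω`, with `s₁ = p₁ + p₂` and `s₂ = 0`.
-/

namespace LocalLinearization

open Matrix

/-! ### Matrix identities over a commutative ring -/

section CommRing

variable {A p q n p₁ q₁ n₁ p₂ q₂ n₂ : Type*} [CommRing A]
  [Fintype p] [DecidableEq p] [DecidableEq q] [Fintype n]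
  [Fintype p₁] [DecidableEq p₁] [Fintype q₁] [DecidableEq q₁] [Fintype n₁]
  [Fintype p₂] [DecidableEq p₂] [DecidableEq q₂] [Fintype n₂]

/-- Right inverses `C` of `K` and `B` of `N`, where `K * Nᵀ = 0`, can be chosen with `Cᵀ * B = 0`.
If moreover `K` and `N` together have as many rows as columns, this says that `[K; Bᵀ]` and
`[C Nᵀ]` are inverse to each other, that is, `K` is completed to an invertible matrix. -/
theorem exists_orthogonal_right_inverses {K : Matrix p n A} {N : Matrix q n A}
    (hKN : K * Nᵀ = 0) (hK : ∃ C : Matrix n p A, K * C = 1) (hN : ∃ B : Matrix n q A, N * B = 1) :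
    ∃ (C : Matrix n p A) (B : Matrix n q A), K * C = 1 ∧ N * B = 1 ∧ Cᵀ * B = 0 := by
  obtain ⟨C, hC⟩ := hK
  obtain ⟨B, hB⟩ := hN
  have hNK : N * Kᵀ = 0 := by
    simpa using congrArg transpose hKN
  have hCK : Cᵀ * Kᵀ = 1 := by
    rw [← transpose_mul, hC, transpose_one]
  refine ⟨C, B - Kᵀ * (Cᵀ * B), hC, ?_, ?_⟩
  · rw [Matrix.mul_sub, ← Matrix.mul_assoc, hNK, Matrix.zero_mul, sub_zero, hB]
  · rw [Matrix.mul_sub, ← Matrix.mul_assoc, hCK, Matrix.one_mul, sub_self]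

/-- If `K₁`, `K₂` and their duals `N₁`, `N₂` are right invertible over `A`, then `[M K₂ᵀ; K₁ 0]`
and `diag(N₂ M N₁ᵀ, I)` are equivalent over `A`. The transforming matrices come from completing
`K₁`, `K₂` to invertible matrices and clearing the off-diagonal blocks of
`[N₂; C₂ᵀ] * M * [N₁ᵀ C₁]`. -/
theorem exists_block_equiv (M : Matrix n₂ n₁ A)
    {K₁ : Matrix p₁ n₁ A} {K₂ : Matrix p₂ n₂ A} {N₁ : Matrix q₁ n₁ A} {N₂ : Matrix q₂ n₂ A}
    (hKN₁ : K₁ * N₁ᵀ = 0) (hKN₂ : K₂ * N₂ᵀ = 0)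
    (hK₁ : ∃ C : Matrix n₁ p₁ A, K₁ * C = 1) (hK₂ : ∃ C : Matrix n₂ p₂ A, K₂ * C = 1)
    (hN₁ : ∃ B : Matrix n₁ q₁ A, N₁ * B = 1) (hN₂ : ∃ B : Matrix n₂ q₂ A, N₂ * B = 1) :
    ∃ (R₁ : Matrix (q₂ ⊕ (p₁ ⊕ p₂)) (n₂ ⊕ p₁) A) (S₁ : Matrix (n₂ ⊕ p₁) (q₂ ⊕ (p₁ ⊕ p₂)) A)
      (R₂ : Matrix (n₁ ⊕ p₂) (q₁ ⊕ (p₁ ⊕ p₂)) A) (S₂ : Matrix (q₁ ⊕ (p₁ ⊕ p₂)) (n₁ ⊕ p₂) A),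
      R₁ * S₁ = 1 ∧ S₂ * R₂ = 1 ∧
        R₁ * fromBlocks M K₂ᵀ K₁ 0 * R₂ = fromBlocks (N₂ * M * N₁ᵀ) 0 0 1 := by
  obtain ⟨C₁, B₁, hC₁, hB₁, hCB₁⟩ := exists_orthogonal_right_inverses hKN₁ hK₁ hN₁
  obtain ⟨C₂, B₂, hC₂, hB₂, hCB₂⟩ := exists_orthogonal_right_inverses hKN₂ hK₂ hN₂
  have hNK₂ : N₂ * K₂ᵀ = 0 := by simpa using congrArg transpose hKN₂
  have hCK₂ : C₂ᵀ * K₂ᵀ = 1 := by rw [← transpose_mul, hC₂, transpose_one]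
  have hBN₁ : B₁ᵀ * N₁ᵀ = 1 := by rw [← transpose_mul, hB₁, transpose_one]
  have hBC₁ : B₁ᵀ * C₁ = 0 := by simpa using congrArg transpose hCB₁
  refine ⟨fromBlocks N₂ (-(N₂ * M * C₁)) (fromRows 0 C₂ᵀ) (fromRows 1 (-(C₂ᵀ * M * C₁))),
    fromBlocks B₂ (fromCols (M * C₁) K₂ᵀ) 0 (fromCols 1 0),
    fromBlocks N₁ᵀ (fromCols C₁ 0) (-(C₂ᵀ * M * N₁ᵀ)) (fromCols 0 1),
    fromBlocks B₁ᵀ 0 (fromRows K₁ (C₂ᵀ * M * N₁ᵀ * B₁ᵀ)) (fromRows 0 1), ?_, ?_, ?_⟩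
  · simp [fromBlocks_multiply, fromRows_mul, mul_fromCols, Matrix.mul_assoc, hB₂, hCB₂, hNK₂, hCK₂]
    ext (i | i | i) (j | j | j) <;> simp [one_apply]
  · simp [fromBlocks_multiply, fromRows_mul, mul_fromCols, Matrix.mul_assoc, hBN₁, hBC₁, hC₁, hKN₁]
    ext (i | i | i) (j | j | j) <;> simp [one_apply]
  · simp [fromBlocks_multiply, fromRows_mul, mul_fromCols, Matrix.mul_assoc, Matrix.add_mul,
      hC₁, hKN₁, hNK₂, hCK₂]
    refine ⟨?_, ?_, ?_⟩
    · ext i (j | j) <;> simp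
    · ext (i | i) j <;> simp
    · ext (i | i) (j | j) <;> simp [one_apply]

end CommRing

/-! ### Rational functions defined on a set -/

noncomputable section

variable {F : Type*} [Field F]

/-- The ring of rational functions without poles in `Ω`. -/
def definedOn (Ω : Set F) : Subring (RatFunc F) where
  carrier := {f | ∀ z ∈ Ω, f.denom.eval z ≠ 0}
  mul_mem' {f g} hf hg z hz h := by
    have := eval_eq_zero_of_dvd_of_eval_eq_zero (RatFunc.denom_mul_dvd f g) h
    simp_all
  one_mem' z _ := by simp
  add_mem' {f g} hf hg z hz h := by
    have := eval_eq_zero_of_dvd_of_eval_eq_zero (RatFunc.denom_add_dvd f g) h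
    simp_all
  zero_mem' z _ := by simp
  neg_mem' {f} hf z hz h := by
    have hd : (-f).denom ∣ f.denom := by
      rw [RatFunc.denom_dvd f.denom_ne_zero]
      exact ⟨-f.num, by rw [map_neg, neg_div, RatFunc.num_div_denom]⟩
    exact hf z hz (eval_eq_zero_of_dvd_of_eval_eq_zero hd h)

variable {Ω : Set F}

/-- Evaluation at a point of `Ω`, as a ring homomorphism on the functions without poles there. -/
def evalHom {z : F} (hz : z ∈ Ω) : definedOn Ω →+* F where
  toFun f := RatFunc.eval (RingHom.id F) z f
  map_one' := by simp
  map_zero' := by simp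
  map_mul' f g :=
    RatFunc.eval_mul _ _ (by simpa using f.2 z hz) (by simpa using g.2 z hz)
  map_add' f g :=
    RatFunc.eval_add _ _ (by simpa using f.2 z hz) (by simpa using g.2 z hz)

/-- Polynomials as rational functions without poles in `Ω`. -/
def polyHom (Ω : Set F) : F[X] →+* definedOn Ω :=
  (algebraMap F[X] (RatFunc F)).codRestrict (definedOn Ω) fun p z _ => by simp

theorem evalHom_polyHom {z : F} (hz : z ∈ Ω) (p : F[X]) :
    evalHom hz (polyHom Ω p) = p.eval z := by
  have h : RatFunc.eval (RingHom.id F) z (algebraMap F[X] (RatFunc F) p) = p.eval z := by simp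
  exact h

theorem polyHom_num (f : definedOn Ω) :
    polyHom Ω (f : RatFunc F).num = f * polyHom Ω (f : RatFunc F).denom := by
  apply Subtype.ext
  have h := RatFunc.num_div_denom (f : RatFunc F)
  rw [div_eq_iff (RatFunc.algebraMap_ne_zero (RatFunc.denom_ne_zero _))] at h
  exact h

theorem isUnit_polyHom {g : F[X]} (hg : g ≠ 0) (h : ∀ z ∈ Ω, g.eval z ≠ 0) :
    IsUnit (polyHom Ω g) := by
  have hg' : algebraMap F[X] (RatFunc F) g ≠ 0 := RatFunc.algebraMap_ne_zero hg
  refine IsUnit.of_mul_eq_one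
    ⟨(algebraMap F[X] (RatFunc F) g)⁻¹, fun z hz h0 => h z hz ?_⟩ (Subtype.ext ?_)
  · have := RatFunc.denom_inv_dvd hg'
    rw [RatFunc.num_algebraMap] at this
    exact eval_eq_zero_of_dvd_of_eval_eq_zero this h0
  · exact mul_inv_cancel₀ hg'

/-! ### Right inverses of matrices of full row rank in a set -/

theorem exists_mul_eq_one_of_rank_eq {p n : ℕ} {K : Matrix (Fin p) (Fin n) F} (h : K.rank = p) :
    ∃ C : Matrix (Fin n) (Fin p) F, K * C = 1 := by
  rw [← mulVec_surjective_iff_exists_right_inverse]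
  have : LinearMap.range K.mulVecLin = ⊤ := Submodule.eq_top_of_finrank_eq (by
    rw [Module.finrank_fin_fun]
    exact h)
  exact LinearMap.range_eq_top.1 this

/-- If the value of `K` at `z ∈ Ω` has full row rank, then `K` has a right inverse up to a
polynomial factor that does not vanish at `z`. -/
theorem exists_mul_eq_smul_one_of_rank_eq {p n : ℕ} {K : Matrix (Fin p) (Fin n) (definedOn Ω)}
    {z : F} (hz : z ∈ Ω) (h : (K.map (evalHom hz)).rank = p) :
    ∃ a : F[X], a.eval z ≠ 0 ∧
      ∃ C : Matrix (Fin n) (Fin p) (definedOn Ω), K * C = polyHom Ω a • 1 := by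
  obtain ⟨C₀, hC₀⟩ := exists_mul_eq_one_of_rank_eq h
  -- A constant right inverse of the value at `z` makes `K * C₁` square with determinant `1` at `z`.
  let C₁ : Matrix (Fin n) (Fin p) (definedOn Ω) := C₀.map fun c => polyHom Ω (Polynomial.C c)
  have hC₁ : C₁.map (evalHom hz) = C₀ := by
    ext i j
    simp [C₁, evalHom_polyHom]
  have hdet : evalHom hz (K * C₁).det = 1 := by
    rw [RingHom.map_det, RingHom.mapMatrix_apply, Matrix.map_mul, hC₁, hC₀, det_one]
  let d := (K * C₁).det
  refine ⟨(d : RatFunc F).num, ?_, polyHom Ω (d : RatFunc F).denom • (C₁ * (K * C₁).adjugate), ?_⟩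
  · rw [← evalHom_polyHom hz, polyHom_num, map_mul, hdet, one_mul, evalHom_polyHom]
    exact d.2 z hz
  · rw [Matrix.mul_smul, ← Matrix.mul_assoc, mul_adjugate, smul_smul, polyHom_num, mul_comm]

/-- A matrix whose values have full row rank at all points of `Ω` is right invertible over the
rational functions without poles in `Ω`: the polynomials `a` for which `a • 1` factors through `K`
form an ideal, and its generator has no zeros in `Ω`. -/
theorem exists_right_inverse (hΩ : Ω.Nonempty) {p n : ℕ}
    {K : Matrix (Fin p) (Fin n) (definedOn Ω)}
    (h : ∀ z (hz : z ∈ Ω), (K.map (evalHom hz)).rank = p) :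
    ∃ C : Matrix (Fin n) (Fin p) (definedOn Ω), K * C = 1 := by
  let J : Ideal F[X] :=
    { carrier := {a | ∃ C : Matrix (Fin n) (Fin p) (definedOn Ω), K * C = polyHom Ω a • 1}
      zero_mem' := ⟨0, by simp⟩
      add_mem' := by
        rintro a b ⟨C, hC⟩ ⟨D, hD⟩
        exact ⟨C + D, by rw [Matrix.mul_add, hC, hD, map_add, add_smul]⟩
      smul_mem' := by
        rintro a b ⟨C, hC⟩
        exact ⟨polyHom Ω a • C, by rw [Matrix.mul_smul, hC, smul_smul, smul_eq_mul, map_mul]⟩ }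
  obtain ⟨g, hg⟩ := (IsPrincipalIdealRing.principal J).principal
  have heval : ∀ z ∈ Ω, g.eval z ≠ 0 := by
    intro z hz h0
    obtain ⟨a, ha, haJ⟩ := exists_mul_eq_smul_one_of_rank_eq hz (h z hz)
    have hmem : a ∈ J := haJ
    rw [hg] at hmem
    exact ha (eval_eq_zero_of_dvd_of_eval_eq_zero (Ideal.mem_span_singleton.1 hmem) h0)
  have hg0 : g ≠ 0 := by
    rintro rfl
    obtain ⟨z, hz⟩ := hΩ
    exact heval z hz eval_zero
  obtain ⟨u, hu⟩ := isUnit_polyHom hg0 heval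
  obtain ⟨C, hC⟩ : g ∈ J := hg ▸ Submodule.mem_span_singleton_self g
  refine ⟨(↑u⁻¹ : definedOn Ω) • C, ?_⟩
  rw [Matrix.mul_smul, hC, ← hu, smul_smul, Units.inv_mul, one_smul]

/-- A rational matrix of full row rank in `Ω` comes from a right invertible matrix over the
rational functions without poles in `Ω`. -/
theorem FullRowRankIn.exists_lift {p n : ℕ} {R : Matrix (Fin p) (Fin n) (RatFunc F)}
    (hΩ : Ω.Nonempty) (h : FullRowRankIn R Ω) :
    ∃ K : Matrix (Fin p) (Fin n) (definedOn Ω),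
      K.map (definedOn Ω).subtype = R ∧
        ∃ C : Matrix (Fin n) (Fin p) (definedOn Ω), K * C = 1 :=
  ⟨of fun i j => ⟨R i j, fun z hz => (h z hz).1 i j⟩, rfl,
    exists_right_inverse hΩ fun z hz => (h z hz).2⟩

theorem regularIn_map_subtype {m : ℕ} {R S : Matrix (Fin m) (Fin m) (definedOn Ω)}
    (h : R * S = 1) : RegularIn (R.map (definedOn Ω).subtype) Ω := by
  refine fun z hz => ⟨fun i j => (R i j).2 z hz, ?_⟩
  have hval : valueAt (R.map (definedOn Ω).subtype) z = (evalHom hz).mapMatrix R := rfl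
  rw [hval]
  refine ((isUnit_iff_isUnit_det _).1 (IsUnit.of_mul_eq_one ((evalHom hz).mapMatrix S) ?_)).ne_zero
  rw [← map_mul, h, map_one]

/-! ### Passage to consecutively numbered rows and columns -/

/-- A matrix that is right invertible over the rational functions without poles in `Ω`, with as many
rows as columns, is regular in `Ω` however its rows and columns are numbered. -/
theorem regularIn_submatrix {m : ℕ} {ι κ : Type*} [Fintype ι] [DecidableEq ι] [Fintype κ]
    [DecidableEq κ] (e : Fin m ≃ ι) (f : Fin m ≃ κ) {R : Matrix ι κ (definedOn Ω)}
    {S : Matrix κ ι (definedOn Ω)} (h : R * S = 1) :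
    RegularIn ((R.submatrix e f).map (definedOn Ω).subtype) Ω :=
  regularIn_map_subtype (S := S.submatrix f e) (by
    rw [submatrix_mul_equiv, h, submatrix_one_equiv])

theorem toRat_blockPencil {p₁ n₁ p₂ n₂ : ℕ} (M : Matrix (Fin n₂) (Fin n₁) F[X])
    (K₁ : Matrix (Fin p₁) (Fin n₁) F[X]) (K₂ : Matrix (Fin p₂) (Fin n₂) F[X]) :
    toRat (blockPencil M K₁ K₂) =
      reindex finSumFinEquiv finSumFinEquiv
        (fromBlocks (toRat M) (toRat K₂)ᵀ (toRat K₁) 0) := by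
  rw [toRat, blockPencil, block, reindex_apply, reindex_apply, ← submatrix_map, fromBlocks_map]
  simp [toRat, transpose_map]

/-- Numbering of a threefold sum, compatible with that of `diag(G, I_{b + c})`. -/
def sumSumEquiv (a b c : ℕ) : Fin a ⊕ (Fin b ⊕ Fin c) ≃ Fin (a + (b + c)) :=
  ((Equiv.refl _).sumCongr finSumFinEquiv).trans finSumFinEquiv

theorem diagId_eq_reindex {p m : ℕ} (G : Matrix (Fin p) (Fin m) (RatFunc F)) (b c : ℕ) :
    diagId G (b + c) =
      reindex (sumSumEquiv p b c) (sumSumEquiv m b c) (fromBlocks G 0 0 1) := by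
  have h : (fromBlocks G 0 0 1 :
      Matrix (Fin p ⊕ (Fin b ⊕ Fin c)) (Fin m ⊕ (Fin b ⊕ Fin c)) (RatFunc F)) =
      (fromBlocks G 0 0 1).submatrix ((Equiv.refl _).sumCongr finSumFinEquiv)
        ((Equiv.refl _).sumCongr finSumFinEquiv) := by
    ext (i | i) (j | j) <;> simp [one_apply]
  rw [h]
  ext i j
  simp [diagId, block, sumSumEquiv]

theorem diagId_zero {p m : ℕ} (G : Matrix (Fin p) (Fin m) (RatFunc F)) : diagId G 0 = G := by
  ext i j
  have hi : finSumFinEquiv.symm i = Sum.inl i := by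
    rw [Equiv.symm_apply_eq]; rfl
  have hj : finSumFinEquiv.symm j = Sum.inl j := by
    rw [Equiv.symm_apply_eq]; rfl
  simp [diagId, block, hi, hj]

theorem transfer_ofEmptyState {q r : ℕ} (D : Matrix (Fin q) (Fin r) F[X]) :
    (PolynomialSystemMatrix.ofEmptyState D).transfer = toRat D := by
  have h : toRat (PolynomialSystemMatrix.ofEmptyState D).B = 0 := by
    ext i
    exact i.elim0
  rw [PolynomialSystemMatrix.transfer, h, Matrix.mul_zero, add_zero]
  rfl

theorem isPencil_toMatrix_ofEmptyState {q r : ℕ} {D : Matrix (Fin q) (Fin r) F[X]}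
    (h : IsPencil D) : IsPencil (PolynomialSystemMatrix.ofEmptyState D).toMatrix := by
  intro i j
  rw [PolynomialSystemMatrix.toMatrix, block, reindex_apply, submatrix_apply]
  rcases finSumFinEquiv.symm i with i | i
  · exact i.elim0
  rcases finSumFinEquiv.symm j with j | j
  · exact j.elim0
  exact h i j

theorem minimalAt_ofEmptyState {q r : ℕ} (D : Matrix (Fin q) (Fin r) F[X]) (z : F) :
    (PolynomialSystemMatrix.ofEmptyState D).MinimalAt z :=
  ⟨Nat.le_zero.1 (rank_le_card_width _), Nat.le_zero.1 (rank_le_card_height _)⟩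

end

end LocalLinearization

/-! ### The block full rank pencil as a linearization -/

open LocalLinearization Matrix

theorem theorem5p3 {F : Type*} [Field F] [IsAlgClosed F] {p₁ q₁ n₁ p₂ q₂ n₂ : ℕ}
    (M : Matrix (Fin n₂) (Fin n₁) F[X])
    (K₁ : Matrix (Fin p₁) (Fin n₁) F[X]) (K₂ : Matrix (Fin p₂) (Fin n₂) F[X])
    (N₁ : Matrix (Fin q₁) (Fin n₁) (RatFunc F)) (N₂ : Matrix (Fin q₂) (Fin n₂) (RatFunc F))
    (hL : LocalLinearization.IsBlockFullRankPencil M K₁ K₂)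
    (hdual₁ : LocalLinearization.AreDualRationalBases (LocalLinearization.toRat K₁) N₁)
    (hdual₂ : LocalLinearization.AreDualRationalBases (LocalLinearization.toRat K₂) N₂)
    (Ω : Set F) (hΩ : Ω.Nonempty)
    (hK₁ : LocalLinearization.FullRowRankIn (LocalLinearization.toRat K₁) Ω)
    (hK₂ : LocalLinearization.FullRowRankIn (LocalLinearization.toRat K₂) Ω)
    (hN₁ : LocalLinearization.FullRowRankIn N₁ Ω)
    (hN₂ : LocalLinearization.FullRowRankIn N₂ Ω) :
    (LocalLinearization.PolynomialSystemMatrix.ofEmptyState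
        (LocalLinearization.blockPencil M K₁ K₂)).IsLinearizationIn
      (N₂ * LocalLinearization.toRat M * N₁.transpose) Ω ∧
    ∃ (hr : q₂ + (p₁ + p₂) = n₂ + p₁) (hc : q₁ + (p₁ + p₂) = n₁ + p₂),
      LocalLinearization.EquivalentIn
        (LocalLinearization.toRat (LocalLinearization.blockPencil M K₁ K₂))
        (Matrix.reindex (finCongr hr) (finCongr hc)
          (LocalLinearization.diagId (N₂ * LocalLinearization.toRat M * N₁.transpose) (p₁ + p₂)))
        Ω := by
  have hr : q₂ + (p₁ + p₂) = n₂ + p₁ := by have := hdual₂.2.2.1; omega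
  have hc : q₁ + (p₁ + p₂) = n₁ + p₂ := by have := hdual₁.2.2.1; omega
  obtain ⟨K₁', hK₁', hC₁⟩ := FullRowRankIn.exists_lift hΩ hK₁
  obtain ⟨K₂', hK₂', hC₂⟩ := FullRowRankIn.exists_lift hΩ hK₂
  obtain ⟨N₁', hN₁', hB₁⟩ := FullRowRankIn.exists_lift hΩ hN₁
  obtain ⟨N₂', hN₂', hB₂⟩ := FullRowRankIn.exists_lift hΩ hN₂
  set ι := (definedOn Ω).subtype
  have hinj : Function.Injective ι := Subtype.val_injective
  have hM' : (M.map (polyHom Ω)).map ι = toRat M := rfl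
  have hKN₁ : K₁' * N₁'ᵀ = 0 := by
    refine Matrix.map_injective hinj ?_
    dsimp only
    rw [Matrix.map_mul, transpose_map, hK₁', hN₁', hdual₁.2.2.2, Matrix.map_zero _ (map_zero _)]
  have hKN₂ : K₂' * N₂'ᵀ = 0 := by
    refine Matrix.map_injective hinj ?_
    dsimp only
    rw [Matrix.map_mul, transpose_map, hK₂', hN₂', hdual₂.2.2.2, Matrix.map_zero _ (map_zero _)]
  obtain ⟨R₁, S₁, R₂, S₂, hRS₁, hSR₂, hEq⟩ :=
    exists_block_equiv (M.map (polyHom Ω)) hKN₁ hKN₂ hC₁ hC₂ hB₁ hB₂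
  let a := finSumFinEquiv (m := n₂) (n := p₁)
  let b := finSumFinEquiv (m := n₁) (n := p₂)
  let c := sumSumEquiv q₂ p₁ p₂
  let d := sumSumEquiv q₁ p₁ p₂
  -- The one-sided inverses are two-sided because `p₁ + q₁ = n₁` and `p₂ + q₂ = n₂`.
  have hSR₁ : S₁ * R₁ = 1 :=
    (mul_eq_one_comm_of_equiv ((c.trans (finCongr hr)).trans a.symm)).1 hRS₁
  have hRS₂ : R₂ * S₂ = 1 :=
    (mul_eq_one_comm_of_equiv ((d.trans (finCongr hc)).trans b.symm)).1 hSR₂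
  have hEqMap : R₁.map ι * fromBlocks (toRat M) (toRat K₂)ᵀ (toRat K₁) 0 * R₂.map ι =
      fromBlocks (N₂ * toRat M * N₁ᵀ) 0 0 1 := by
    have h := congrArg (fun X => X.map ι) hEq
    simpa [Matrix.map_mul, fromBlocks_map, transpose_map, hK₁', hK₂', hN₁', hN₂', hM',
      Matrix.map_zero, Matrix.map_one] using h
  have hEqMap' : S₁.map ι * (fromBlocks (N₂ * toRat M * N₁ᵀ) 0 0 1 :
      Matrix (Fin q₂ ⊕ (Fin p₁ ⊕ Fin p₂)) (Fin q₁ ⊕ (Fin p₁ ⊕ Fin p₂)) (RatFunc F)) * S₂.map ι =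
      fromBlocks (toRat M) (toRat K₂)ᵀ (toRat K₁) 0 := by
    have h₁ : S₁.map ι * R₁.map ι = (1 : Matrix _ _ (RatFunc F)) := by
      rw [← Matrix.map_mul, hSR₁, Matrix.map_one _ (map_zero _) (map_one _)]
    have h₂ : R₂.map ι * S₂.map ι = 1 := by
      rw [← Matrix.map_mul, hRS₂, Matrix.map_one _ (map_zero _) (map_one _)]
    rw [← hEqMap, ← Matrix.mul_assoc, ← Matrix.mul_assoc, h₁, Matrix.one_mul, Matrix.mul_assoc, h₂,
      Matrix.mul_one]
  refine ⟨fun z hz => ⟨isPencil_toMatrix_ofEmptyState hL.1, minimalAt_ofEmptyState _ z,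
    p₁ + p₂, 0, hr.symm, hc.symm,
    (S₁.submatrix ((finCongr hr).trans a.symm) c.symm).map ι,
    (S₂.submatrix d.symm ((finCongr hc).trans b.symm)).map ι,
    regularIn_submatrix _ _ hSR₁ z hz, regularIn_submatrix _ _ hSR₂ z hz, ?_⟩,
    hr, hc,
    (R₁.submatrix ((finCongr hr.symm).trans c.symm) a.symm).map ι,
    (R₂.submatrix b.symm ((finCongr hc.symm).trans d.symm)).map ι,
    regularIn_submatrix _ _ hRS₁, regularIn_submatrix _ _ hRS₂, ?_⟩
  · rw [diagId_zero, transfer_ofEmptyState, toRat_blockPencil, diagId_eq_reindex, ← hEqMap']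
    simp only [reindex_apply, ← submatrix_map, c, d, submatrix_mul_equiv]
    rfl
  · rw [toRat_blockPencil, diagId_eq_reindex, ← hEqMap]
    simp only [reindex_apply, ← submatrix_map, a, b, submatrix_mul_equiv]
    rfl
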